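/- Let $\mathbb{T}^\infty=\{(z_1,z_2,\ldots): |z_n|=1\}$ be the infinite-dimensional torus, a compact abelian group with normalised Haar measure $\mathrm{d}\theta=\mathrm{d}\theta_1\times\mathrm{d}\theta_2\times\cdots$. Let $\mathbb{Z}_0^\infty$ be the set of integer sequences $\nu=(\nu_1,\nu_2,\ldots)$ with only finitely many non-zero terms, and let $\mathbb{N}_0^\infty\subset\mathbb{Z}_0^\infty$ be the subset of those with all $\nu_j\ge 0$. For a complex Borel measure $\mu$ on $\mathbb{T}^\infty$ put $\widehat\mu(\nu)=\int_{\mathbb{T}^\infty} e^{-i\theta\cdot\nu}\,\mathrm{d}\mu(\theta)$ for $\nu\in\mathbb{Z}_0^\infty$, and for $f\in L^1(\mathbb{T}^\infty)$ put $\widehat f(\nu)=\int_{\mathbb{T}^\infty} f(e^{i\theta})e^{-i\theta\cdot\nu}\,\mathrm{d}\theta$. The measure $\mu$ is called analytic if $\widehat\mu(\nu)=0$ for every $\nu\in\mathbb{Z}_0^\infty\setminus\mathbb{N}_0^\infty$, and $H^1(\mathbb{T}^\infty)$ denotes the set of $f\in L^1(\mathbb{T}^\infty)$ with $\widehat f(\nu)=0$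 for every $\nu\in\mathbb{Z}_0^\infty\setminus\mathbb{N}_0^\infty$. **Theorem (F. and M. Riesz theorem I).** Every analytic complex Borel measure $\mu$ on $\mathbb{T}^\infty$ is absolutely continuous with respect to the Haar measure, and its density belongs to $H^1(\mathbb{T}^\infty)$: there is $g\in H^1(\mathbb{T}^\infty)$ with $\mathrm{d}\mu=g\,\mathrm{d}\theta$. -/

import Mathlib

open MeasureTheory
open scoped ENNReal ComplexConjugate

namespace InfiniteTorus

/-- The infinite-dimensional torus `𝕋^∞ = {(z₁, z₂, …) : zₙ ∈ 𝕋}`, a compact abelian group with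
the product topology; its measurable structure is the Borel σ-algebra. -/
abbrev Torus : Type := ℕ → Circle

/-- The circle carries its Borel σ-algebra. Countable products of second countable spaces being
compatible with Borel σ-algebras, the product σ-algebra on `𝕋^∞` is its Borel σ-algebra. -/
noncomputable instance instMeasurableSpaceCircle : MeasurableSpace Circle := borel Circle

instance instBorelSpaceCircle : BorelSpace Circle := ⟨rfl⟩

/-- The Haar measure of `𝕋^∞`, normalised to have total mass one. -/
noncomputable def haar : Measure Torus := Measure.haarMeasure ⊤

/-- The character `e^{iθ·ν} = z₁^{ν₁} z₂^{ν₂} ⋯` of `𝕋^∞` for an integer multi-index `ν` with only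
finitely many non-zero components. -/
noncomputable def character (ν : ℕ →₀ ℤ) (z : Torus) : ℂ :=
  ((ν.prod fun j k => z j ^ k : Circle) : ℂ)

/-- `ν ∈ ℕ₀^∞`: all components of the multi-index are non-negative. -/
def IsNonneg (ν : ℕ →₀ ℤ) : Prop := ∀ j, 0 ≤ ν j

/-- The Fourier coefficient `f̂(ν) = ∫ f(e^{iθ}) e^{-iθ·ν} dθ` of a function on `𝕋^∞`. -/
noncomputable def fourierCoeff (f : Torus → ℂ) (ν : ℕ →₀ ℤ) : ℂ :=
  ∫ z, conj (character ν z) * f z ∂haar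

/-- The Fourier coefficient `μ̂(ν) = ∫ e^{-iθ·ν} dμ(θ)` of a complex Borel measure on `𝕋^∞`. -/
noncomputable def measureFourierCoeff (μ : ComplexMeasure Torus) (ν : ℕ →₀ ℤ) : ℂ :=
  ∫ᵛ z, conj (character ν z) ∂[ContinuousLinearMap.mul ℝ ℂ; μ]

/-- A complex Borel measure on `𝕋^∞` is analytic if `μ̂(ν) = 0` for all `ν ∉ ℕ₀^∞`. -/
def IsAnalyticMeasure (μ : ComplexMeasure Torus) : Prop :=
  ∀ ν : ℕ →₀ ℤ, ¬ IsNonneg ν → measureFourierCoeff μ ν = 0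

/-- The Hardy space `H^p(𝕋^∞)`, `1 ≤ p ≤ ∞`: the functions in `L^p(𝕋^∞)` whose Fourier series is
supported on `ℕ₀^∞`. -/
def hardySpace (p : ℝ≥0∞) [Fact (1 ≤ p)] : Set (Lp ℂ p haar) :=
  {f | ∀ ν : ℕ →₀ ℤ, ¬ IsNonneg ν → fourierCoeff f ν = 0}

end InfiniteTorus

namespace InfiniteTorus

/-! ### Characters -/

/-! Choose a finite ρ ≥ dθ with μ = φ dρ, φ ∈ L²(ρ) (`exists_bounded_density`), and write dθ = v dρ.
It suffices that φ = 0 a.e. on {v = 0}: then φ/v is the density.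

Order the multi-indices by ν ↦ ∑ νⱼ log pⱼ. The core, `integral_singular_eq_zero`, is a Hilbert
space argument: let h be the component of 1 orthogonal in L²(ρ) to the characters of positive index.
Every Fourier coefficient of |h|² dρ except the zeroth vanishes, so |h|² = c v, and c ≠ 0. Hence h
vanishes exactly on {v = 0}, and its multiples by characters are orthogonal and complete in L² of {v
≠ 0}. Comparing coefficients in this system shows that if φ dρ has no negative frequencies, its part
on {v ≠ 0} already carries all its mass.

Analyticity then gives more than vanishing on a half-space: only finitely many indices of ℕ₀^∞ lie
below a given level (`finite_isNonneg_logWeight_lt`). So after multiplying μ by any character,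
finitely many negative frequencies remain, and subtracting a trigonometric polynomial times dθ
removes them without changing the singular part. Thus all Fourier coefficients of the singular part
vanish (`density_ae_eq_zero_of_analytic`). -/

lemma character_zero (z : Torus) : character 0 z = 1 := by
  simp [character]

lemma character_add (ν κ : ℕ →₀ ℤ) (z : Torus) :
    character (ν + κ) z = character ν z * character κ z := by
  rw [character, Finsupp.prod_add_index' (fun _ => zpow_zero _) (fun _ _ _ => zpow_add _ _ _),
    Circle.coe_mul, character, character]

lemma norm_character (ν : ℕ →₀ ℤ) (z : Torus) : ‖character ν z‖ = 1 :=
  Circle.norm_coe _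

lemma conj_character (ν : ℕ →₀ ℤ) (z : Torus) : conj (character ν z) = character (-ν) z := by
  rw [character, character, ← Circle.coe_inv_eq_conj, Finsupp.prod_neg_index (fun _ => zpow_zero _)]
  simp [Finsupp.prod]

lemma character_mul_point (ν : ℕ →₀ ℤ) (w z : Torus) :
    character ν (w * z) = character ν w * character ν z := by
  simp only [character, Pi.mul_apply, mul_zpow, Finsupp.prod_mul, Circle.coe_mul]

lemma continuous_character (ν : ℕ →₀ ℤ) : Continuous (character ν) := by
  have h : Continuous fun z : Torus => (ν.prod fun j k => z j ^ k : Circle) :=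
    continuous_finsetProd _ fun j _ => (continuous_apply j).zpow _
  exact continuous_subtype_val.comp h

lemma character_single (j : ℕ) (k : ℤ) (z : Torus) :
    character (Finsupp.single j k) z = ((z j ^ k : Circle) : ℂ) := by
  rw [character, Finsupp.prod_single_index (zpow_zero _)]

/-- The character of index `ν`, as a continuous map. -/
noncomputable def characterMap (ν : ℕ →₀ ℤ) : C(Torus, ℂ) := ⟨character ν, continuous_character ν⟩

/-- Trigonometric polynomials are dense in the continuous functions on `𝕋^∞`. -/
lemma span_characterMap_closure_eq_top :
    (Submodule.span ℂ (Set.range characterMap)).topologicalClosure = ⊤ := by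
  let S : StarSubalgebra ℂ C(Torus, ℂ) :=
    { toSubalgebra := Algebra.adjoin ℂ (Set.range characterMap)
      star_mem' := by
        change Algebra.adjoin ℂ (Set.range characterMap) ≤
          star (Algebra.adjoin ℂ (Set.range characterMap))
        refine Algebra.adjoin_le ?_
        rintro _ ⟨ν, rfl⟩
        refine Algebra.subset_adjoin ⟨-ν, ?_⟩
        ext z
        exact (conj_character ν z).symm }
  have hS : S.toSubalgebra.toSubmodule = Submodule.span ℂ (Set.range characterMap) := by
    apply Algebra.adjoin_eq_span_of_subset
    refine .trans (fun x ↦ Submonoid.closure_induction (fun _ ↦ id) ⟨0, ?_⟩ ?_)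
      Submodule.subset_span
    · ext z
      exact character_zero z
    · rintro _ _ _ _ ⟨ν, rfl⟩ ⟨κ, rfl⟩
      refine ⟨ν + κ, ?_⟩
      ext z
      exact character_add ν κ z
  have hsep : S.SeparatesPoints := by
    intro x y hxy
    obtain ⟨j, hj⟩ := Function.ne_iff.mp hxy
    refine ⟨_, ⟨characterMap (Finsupp.single j 1), Algebra.subset_adjoin ⟨_, rfl⟩, rfl⟩, ?_⟩
    change character _ x ≠ character _ y
    rw [character_single, character_single, zpow_one, zpow_one]
    exact fun h => hj (Circle.ext h)
  rw [← hS]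
  exact congrArg (fun T : StarSubalgebra ℂ C(Torus, ℂ) => T.toSubalgebra.toSubmodule)
    (ContinuousMap.starSubalgebra_topologicalClosure_eq_top_of_separatesPoints S hsep)

lemma integrable_character_mul {ρ : Measure Torus} {g : Torus → ℂ} (hg : Integrable g ρ) (ν : ℕ →₀ ℤ) :
    Integrable (fun z => character ν z * g z) ρ :=
  hg.bdd_mul (continuous_character ν).aestronglyMeasurable
    (Filter.Eventually.of_forall fun z => (norm_character ν z).le)

lemma integral_continuousMap_mul_eq_zero {ρ : Measure Torus} {g : Torus → ℂ} (hg : Integrable g ρ)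
    (h : ∀ ν, ∫ z, character ν z * g z ∂ρ = 0) (F : C(Torus, ℂ)) :
    ∫ z, F z * g z ∂ρ = 0 := by
  have hint : ∀ F : C(Torus, ℂ), Integrable (fun z => F z * g z) ρ := fun F =>
    hg.bdd_mul F.continuous.aestronglyMeasurable
      (Filter.Eventually.of_forall fun z => F.norm_coe_le_norm z)
  let T : C(Torus, ℂ) →L[ℂ] ℂ := LinearMap.mkContinuous
    { toFun := fun F => ∫ z, F z * g z ∂ρ
      map_add' := fun F G => by
        simp only [ContinuousMap.add_apply, add_mul]
        exact integral_add (hint F) (hint G)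
      map_smul' := fun c F => by
        simp only [ContinuousMap.smul_apply, smul_eq_mul, mul_assoc, RingHom.id_apply]
        exact integral_const_mul _ _ } (∫ z, ‖g z‖ ∂ρ) (fun F => by
        change ‖∫ z, F z * g z ∂ρ‖ ≤ _
        rw [mul_comm, ← integral_const_mul]
        refine norm_integral_le_of_norm_le (hg.norm.const_mul _)
          (Filter.Eventually.of_forall fun z => ?_)
        rw [norm_mul]
        gcongr
        exact F.norm_coe_le_norm z)
  have hle : (Submodule.span ℂ (Set.range characterMap)).topologicalClosure ≤
      LinearMap.ker (T : C(Torus, ℂ) →ₗ[ℂ] ℂ) := by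
    refine Submodule.topologicalClosure_minimal _ (Submodule.span_le.mpr ?_) T.isClosed_ker
    rintro _ ⟨ν, rfl⟩
    exact h ν
  rw [span_characterMap_closure_eq_top] at hle
  exact hle (Submodule.mem_top (x := F))

/-- A function integrable against a finite measure on `𝕋^∞` is determined by the integrals of its
products with characters. -/
lemma ae_eq_zero_of_integral_character_mul {ρ : Measure Torus} {g : Torus → ℂ}
    (hg : Integrable g ρ)
    (h : ∀ ν, ∫ z, character ν z * g z ∂ρ = 0) : g =ᵐ[ρ] 0 := by
  wlog hm : StronglyMeasurable g generalizing g
  · have hae := hg.aestronglyMeasurable.ae_eq_mk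
    refine hae.trans (this (hg.congr hae) (fun ν => ?_) hg.aestronglyMeasurable.stronglyMeasurable_mk)
    rw [← h ν]
    refine integral_congr_ae ?_
    filter_upwards [hae] with z hz
    rw [hz]
  -- Polar decomposition g = |g| u: the bounded function u lies in L²(|g| dρ), where continuous
  -- functions are dense.
  let ρ' : Measure Torus := ρ.withDensity fun z => (‖g z‖₊ : ℝ≥0∞)
  have : IsFiniteMeasure ρ' := isFiniteMeasure_withDensity hg.2.ne
  let u : Torus → ℂ := fun z => (‖g z‖⁻¹ : ℝ) • g z
  have hum : StronglyMeasurable u := hm.norm.measurable.inv.stronglyMeasurable.smul hm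
  have hub : ∀ z, ‖conj (u z)‖ ≤ 1 := fun z => by
    simp only [u, RCLike.norm_conj, norm_smul, norm_inv, norm_norm]
    exact inv_mul_le_one
  have hu2 : MemLp (fun z => conj (u z)) 2 ρ' :=
    MemLp.of_bound (Complex.continuous_conj.comp_stronglyMeasurable hum).aestronglyMeasurable 1
      (Filter.Eventually.of_forall hub)
  have hgu : ∀ z, (‖g z‖₊ : ℝ) • u z = g z := fun z => by
    by_cases hz : g z = 0
    · simp [u, hz]
    · simp only [u, smul_smul, coe_nnnorm]
      rw [mul_inv_cancel₀ (norm_ne_zero_iff.mpr hz), one_smul]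
  have hzero : hu2.toLp = 0 := by
    have hd := ContinuousMap.toLp_denseRange (p := 2) ℂ ρ' ℂ (by simp)
    refine hd.eq_zero_of_inner_left (𝕜 := ℂ) ?_
    intro F
    rw [L2.inner_def, ← integral_continuousMap_mul_eq_zero hg h F]
    have e1 : ∫ z, F z * g z ∂ρ = ∫ z, F z * u z ∂ρ' := by
      rw [integral_withDensity_eq_integral_smul hm.nnnorm.measurable]
      refine integral_congr_ae (Filter.Eventually.of_forall fun z => ?_)
      simp only [NNReal.smul_def]
      rw [← mul_smul_comm, hgu]
    rw [e1]
    refine integral_congr_ae ?_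
    filter_upwards [hu2.coeFn_toLp, ContinuousMap.coeFn_toLp (p := 2) (𝕜 := ℂ) ρ' F] with z h1 h2
    rw [h1, h2]
    simp
  have hu0 : ∀ᵐ z ∂ρ', u z = 0 := by
    have h0 := hu2.coeFn_toLp
    rw [hzero] at h0
    filter_upwards [h0, Lp.coeFn_zero ℂ 2 ρ'] with z h1 h2
    rw [h2] at h1
    simpa using h1.symm
  rw [ae_withDensity_iff hm.nnnorm.measurable.coe_nnreal_ennreal] at hu0
  filter_upwards [hu0] with z hz
  by_contra hne
  have hne' : g z ≠ 0 := hne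
  refine hne ?_
  rw [← hgu z, hz (by simpa using hne')]
  simp

/-! ### Haar measure -/

instance instIsProbabilityMeasureHaar : IsProbabilityMeasure haar :=
  ⟨by simpa [haar] using Measure.haarMeasure_self (K₀ := (⊤ : TopologicalSpace.PositiveCompacts Torus))⟩

lemma integral_character_haar (ν : ℕ →₀ ℤ) :
    ∫ z, character ν z ∂haar = if ν = 0 then 1 else 0 := by
  split_ifs with h
  · simp [h, character_zero]
  · obtain ⟨j, hj⟩ := Finsupp.ne_iff.mp h
    have hj' : (ν j : ℝ) ≠ 0 := by exact_mod_cast hj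
    -- Translation by this w multiplies the character by exp(iπ) = -1, so invariance makes the
    -- integral its own negative.
    let w : Torus := Function.update 1 j (Circle.exp (Real.pi / ν j))
    have hw : character ν w = -1 := by
      rw [character, Finsupp.prod, Finset.prod_eq_single j]
      · simp only [w, Function.update_self]
        rw [← Circle.exp_zsmul, zsmul_eq_mul, mul_div_cancel₀ _ hj', Circle.coe_exp,
          Complex.exp_pi_mul_I]
      · intro i _ hi
        simp [w, Function.update_of_ne hi]
      · intro hj
        simp [Finsupp.notMem_support_iff.mp hj]
    have : haar.IsMulLeftInvariant := by unfold haar; infer_instance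
    have h1 := integral_mul_left_eq_self (μ := haar) (character ν) w
    simp only [character_mul_point, hw, neg_mul, one_mul, integral_neg] at h1
    exact self_eq_neg.mp h1.symm

/-! ### Bohr's ordering of the multi-indices -/

/-- The additive map `ν ↦ ∑ⱼ νⱼ log pⱼ`, where `pⱼ` is the `j`-th prime. -/
noncomputable def logWeight : (ℕ →₀ ℤ) →+ ℝ :=
  Finsupp.liftAddHom fun j => (AddMonoidHom.mulRight (Real.log (Nat.nth Nat.Prime j))).comp
    (Int.castAddHom ℝ)

/-- The positive integer `∏ⱼ pⱼ ^ aⱼ`. -/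
noncomputable def primeProd (a : ℕ →₀ ℕ) : ℕ := a.prod fun j k => Nat.nth Nat.Prime j ^ k

lemma prime_nth (j : ℕ) : (Nat.nth Nat.Prime j).Prime := Nat.prime_nth_prime j

lemma primeProd_injective : Function.Injective primeProd := by
  let f : ℕ ↪ ℕ := ⟨Nat.nth Nat.Prime, Nat.nth_injective Nat.infinite_setOfPred_prime⟩
  have key : ∀ a, (primeProd a).factorization = a.embDomain f := fun a => by
    have : primeProd a = (a.embDomain f).prod fun p k => p ^ k := by
      rw [Finsupp.prod_embDomain]; rfl
    rw [this]
    refine Nat.prod_pow_factorization_eq_self fun p hp => ?_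
    rw [Finsupp.support_embDomain, Finset.mem_map] at hp
    obtain ⟨j, _, rfl⟩ := hp
    exact prime_nth j
  intro a b hab
  exact Finsupp.embDomain_injective f (by rw [← key, ← key, hab])

lemma primeProd_pos (a : ℕ →₀ ℕ) : 0 < primeProd a :=
  Finset.prod_pos fun j _ => pow_pos (prime_nth j).pos _

lemma logWeight_natCast (a : ℕ →₀ ℕ) :
    logWeight (a.mapRange (Nat.cast : ℕ → ℤ) Nat.cast_zero) = Real.log (primeProd a) := by
  rw [logWeight, Finsupp.liftAddHom_apply, Finsupp.sum_mapRange_index (fun _ => map_zero _), primeProd,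
    Finsupp.prod, Nat.cast_prod, Real.log_prod]
  · simp [Finsupp.sum, Real.log_pow]
  · intro j _
    exact_mod_cast (pow_pos (prime_nth j).pos _).ne'

/-- Unique factorisation: splitting ν into positive and negative parts, weight zero means that two
products of primes agree. -/
lemma logWeight_injective : Function.Injective logWeight := by
  rw [injective_iff_map_eq_zero]
  intro ν hν
  let a : ℕ →₀ ℕ := ν.mapRange Int.toNat rfl
  let b : ℕ →₀ ℕ := (-ν).mapRange Int.toNat rfl
  have hab : ν = a.mapRange (Nat.cast : ℕ → ℤ) Nat.cast_zero -
      b.mapRange (Nat.cast : ℕ → ℤ) Nat.cast_zero := by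
    ext j
    simp only [a, b, Finsupp.coe_sub, Pi.sub_apply, Finsupp.mapRange_apply, Finsupp.coe_neg,
      Pi.neg_apply]
    omega
  rw [hab, map_sub, logWeight_natCast, logWeight_natCast, sub_eq_zero] at hν
  have h := Real.log_injOn_pos (Set.mem_Ioi.mpr (Nat.cast_pos.mpr (primeProd_pos a)))
    (Set.mem_Ioi.mpr (Nat.cast_pos.mpr (primeProd_pos b))) hν
  rw [hab, primeProd_injective (Nat.cast_injective h), sub_self]

/-- Non-negative indices correspond to positive integers n with weight log n, and only finitely many
n are below exp x. -/
lemma finite_isNonneg_logWeight_lt (x : ℝ) : {ν | IsNonneg ν ∧ logWeight ν < x}.Finite := by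
  have hfin : {a : ℕ →₀ ℕ | Real.log (primeProd a) < x}.Finite := by
    refine Set.Finite.of_finite_image (f := primeProd) ?_ primeProd_injective.injOn
    refine (Set.finite_Iic ⌊Real.exp x⌋₊).subset ?_
    rintro _ ⟨a, ha, rfl⟩
    refine Nat.le_floor (le_of_lt ?_)
    rwa [← Real.log_lt_iff_lt_exp (Nat.cast_pos.mpr (primeProd_pos a))]
  refine (hfin.image fun a => a.mapRange (Nat.cast : ℕ → ℤ) Nat.cast_zero).subset ?_
  rintro ν ⟨hν, hx⟩
  have hν' : (ν.mapRange Int.toNat rfl).mapRange (Nat.cast : ℕ → ℤ) Nat.cast_zero = ν := by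
    ext j
    simp [hν j]
  refine ⟨ν.mapRange Int.toNat rfl, ?_, hν'⟩
  rw [Set.mem_ofPred_eq, ← logWeight_natCast, hν']
  exact hx

/-! ### Orthogonality in Hilbert spaces -/

section Hilbert

variable {H : Type*} [NormedAddCommGroup H] [InnerProductSpace ℂ H]

lemma inner_eq_zero_of_mem_topologicalClosure_span {s : Set H} {x y : H}
    (hx : x ∈ (Submodule.span ℂ s).topologicalClosure) (h : ∀ w ∈ s, inner ℂ y w = 0) :
    inner ℂ y x = 0 := by
  have hle : (Submodule.span ℂ s).topologicalClosure ≤ (Submodule.span ℂ {y})ᗮ :=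
    Submodule.topologicalClosure_minimal _
      (Submodule.span_le.mpr fun w hw => Submodule.mem_orthogonal_singleton_iff_inner_right.mpr
        (h w hw)) (Submodule.isClosed_orthogonal _)
  exact Submodule.mem_orthogonal_singleton_iff_inner_right.mp (hle hx)

variable [CompleteSpace H]

lemma exists_sub_projection (s : Set H) (x : H) :
    ∃ h : H, (∀ w ∈ s, inner ℂ h w = 0) ∧
      ∀ y, (∀ w ∈ s, inner ℂ y w = 0) → inner ℂ y h = inner ℂ y x := by
  set A := (Submodule.span ℂ s).topologicalClosure
  refine ⟨x - A.starProjection x, fun w hw => ?_, fun y hy => ?_⟩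
  · exact Submodule.starProjection_inner_eq_zero x w
      (Submodule.le_topologicalClosure _ (Submodule.subset_span hw))
  · rw [inner_sub_right, inner_eq_zero_of_mem_topologicalClosure_span
      (Submodule.starProjection_apply_mem A x) hy, sub_zero]

/-- The component x of u orthogonal to the `b i`, i ∈ S, is orthogonal to every `b i`; then `hc`
gives ‖x‖² = ⟪x, u⟫ = 0. So u lies in the closed span over S, to which z is orthogonal. Completeness
of the family is needed only as seen by u. -/
lemma inner_eq_zero_of_orthogonal_split {ι : Type*} (b : ι → H) (S : Set ι)
    (hb : ∀ i ∈ S, ∀ j ∉ S, inner ℂ (b j) (b i) = 0) {z u : H}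
    (hz : ∀ i ∈ S, inner ℂ z (b i) = 0) (hu : ∀ j ∉ S, inner ℂ (b j) u = 0)
    (hc : ∀ x, (∀ i, inner ℂ x (b i) = 0) → inner ℂ x u = 0) : inner ℂ z u = 0 := by
  obtain ⟨x, hx, hy⟩ := exists_sub_projection (b '' S) u
  rw [Set.forall_mem_image] at hx
  have hxb : ∀ i, inner ℂ x (b i) = 0 := fun i => by
    by_cases hi : i ∈ S
    · exact hx hi
    · rw [← inner_conj_symm, hy _ (by rw [Set.forall_mem_image]; exact fun j hj => hb j hj i hi),
        hu i hi, map_zero]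
  have hx0 : x = 0 := by
    rw [← inner_self_eq_zero (𝕜 := ℂ), hy x (by rw [Set.forall_mem_image]; exact hx), hc x hxb]
  rw [← hy z (by rw [Set.forall_mem_image]; exact hz), hx0, inner_zero_right]

end Hilbert

/-! ### Multiplication by characters on `L²(ρ)` -/

section CharMul

variable {ρ : Measure Torus}

lemma memLp_character_mul (ν : ℕ →₀ ℤ) {g : Torus → ℂ} (hg : MemLp g 2 ρ) :
    MemLp (fun z => character ν z * g z) 2 ρ :=
  hg.of_le ((continuous_character ν).aestronglyMeasurable.mul hg.1)
    (Filter.Eventually.of_forall fun z => by rw [norm_mul, norm_character, one_mul])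

/-- Multiplication by the character of index `ν` on `L²(ρ)`. -/
noncomputable def charMul (ν : ℕ →₀ ℤ) (f : Lp ℂ 2 ρ) : Lp ℂ 2 ρ :=
  (memLp_character_mul ν (Lp.memLp f)).toLp

lemma coeFn_charMul (ν : ℕ →₀ ℤ) (f : Lp ℂ 2 ρ) :
    charMul ν f =ᵐ[ρ] fun z => character ν z * f z :=
  MemLp.coeFn_toLp _

lemma inner_charMul_right (ν : ℕ →₀ ℤ) (f g : Lp ℂ 2 ρ) :
    inner ℂ f (charMul ν g) = ∫ z, character ν z * (conj (f z) * g z) ∂ρ := by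
  rw [L2.inner_def]
  refine integral_congr_ae ?_
  filter_upwards [coeFn_charMul ν g] with z hz
  rw [hz, RCLike.inner_apply]
  ring

lemma inner_charMul_left (ν : ℕ →₀ ℤ) (f g : Lp ℂ 2 ρ) :
    inner ℂ (charMul ν f) g = inner ℂ f (charMul (-ν) g) := by
  rw [inner_charMul_right, L2.inner_def]
  refine integral_congr_ae ?_
  filter_upwards [coeFn_charMul ν f] with z hz
  rw [hz, RCLike.inner_apply, map_mul, conj_character]
  ring

lemma charMul_add (ν κ : ℕ →₀ ℤ) (f : Lp ℂ 2 ρ) :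
    charMul ν (charMul κ f) = charMul (ν + κ) f := by
  refine Lp.ext ?_
  filter_upwards [coeFn_charMul ν (charMul κ f), coeFn_charMul κ f, coeFn_charMul (ν + κ) f]
    with z h1 h2 h3
  rw [h1, h2, h3, character_add, mul_assoc]

lemma charMul_zero (f : Lp ℂ 2 ρ) : charMul 0 f = f := by
  refine Lp.ext ?_
  filter_upwards [coeFn_charMul 0 f] with z h
  rw [h, character_zero, one_mul]

lemma integrable_conj_mul (f g : Lp ℂ 2 ρ) : Integrable (fun z => conj (f z) * g z) ρ := by
  refine (L2.integrable_inner (𝕜 := ℂ) f g).congr (Filter.Eventually.of_forall fun z => ?_)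
  simp only [RCLike.inner_apply]
  ring

end CharMul

/-! ### The theorem of Helson and Lowdenslager -/

/-- Let `v` be a bounded density of the Haar measure with respect to a finite measure `ρ`. If
`φ ∈ L²(ρ)` and the Fourier coefficients of `φ dρ` vanish at the negative multi-indices of Bohr's
ordering, then the Haar-singular part of `φ dρ` has total mass zero. -/
theorem integral_singular_eq_zero {ρ : Measure Torus} [IsFiniteMeasure ρ] {v : Torus → ℝ}
    (hvm : Measurable v) (hvb : ∀ᵐ z ∂ρ, ‖v z‖ ≤ 1)
    (hv : ∀ ν, ∫ z, character ν z * v z ∂ρ = if ν = 0 then 1 else 0)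
    {φ : Torus → ℂ} (hφ : MemLp φ 2 ρ)
    (h0 : ∀ ν, 0 < logWeight ν → ∫ z, character ν z * φ z ∂ρ = 0) :
    ∫ z in {z | v z = 0}, φ z ∂ρ = 0 := by
  have hone : MemLp (fun _ : Torus => (1 : ℂ)) 2 ρ := memLp_const 1
  let one : Lp ℂ 2 ρ := hone.toLp
  have hone' : one =ᵐ[ρ] fun _ => 1 := hone.coeFn_toLp
  have inner_char : ∀ {f : Torus → ℂ} (hf : MemLp f 2 ρ) (ν),
      inner ℂ hf.toLp (charMul ν one) = ∫ z, character ν z * conj (f z) ∂ρ := fun hf ν => by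
    rw [inner_charMul_right]
    refine integral_congr_ae ?_
    filter_upwards [hf.coeFn_toLp, hone'] with z h1 h2
    rw [h1, h2, mul_one]
  obtain ⟨h, hh, hproj⟩ := exists_sub_projection
    ((fun ν => charMul ν one) '' {ν | 0 < logWeight ν}) one
  simp only [Set.forall_mem_image, Set.mem_ofPred_eq] at hh hproj
  set c : ℂ := inner ℂ h h with hc
  have hc1 : inner ℂ h one = c := (hproj h hh).symm
  -- shifting a vector orthogonal to the positive characters
  have hshift : ∀ y : Lp ℂ 2 ρ, (∀ ν, 0 < logWeight ν → inner ℂ y (charMul ν one) = 0) →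
      ∀ κ, 0 ≤ logWeight κ → inner ℂ y (charMul κ h) = inner ℂ y (charMul κ one) := by
    intro y hy κ hκ
    -- Moving κ to the left factor keeps y orthogonal to the positive characters, since their
    -- indices are only shifted upwards.
    have := hproj (charMul (-κ) y) fun ν hν => by
      rw [inner_charMul_left, neg_neg, charMul_add]
      exact hy _ (by rw [map_add]; positivity)
    rwa [inner_charMul_left, inner_charMul_left, neg_neg] at this
  have hhh : ∀ κ, inner ℂ h (charMul κ h) = if κ = 0 then c else 0 := by
    intro κ
    split_ifs with hκ
    · rw [hκ, charMul_zero]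
    · have hpos : ∀ κ, 0 < logWeight κ → inner ℂ h (charMul κ h) = 0 := fun κ hκ => by
        rw [hshift h (fun ν hν => hh hν) κ hκ.le, hh hκ]
      rcases lt_trichotomy (logWeight κ) 0 with hlt | heq | hgt
      · rw [← neg_neg κ, ← inner_charMul_left, ← inner_conj_symm,
          hpos (-κ) (by rw [map_neg]; exact neg_pos.mpr hlt), map_zero]
      · exact absurd (logWeight_injective (heq.trans (map_zero _).symm)) hκ
      · exact hpos κ hgt
  have hbb : ∀ κ ν, inner ℂ (charMul κ h) (charMul ν h) = if ν = κ then c else 0 := by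
    intro κ ν
    rw [inner_charMul_left, charMul_add, hhh]
    simp only [neg_add_eq_zero, eq_comm]
  -- the constant `c` does not vanish
  have hvc : MemLp (fun z => (v z : ℂ)) 2 ρ :=
    MemLp.of_bound (Complex.measurable_ofReal.comp hvm).aestronglyMeasurable 1
      (hvb.mono fun z hz => by rwa [Complex.norm_real])
  have hvchar : ∀ ν, inner ℂ hvc.toLp (charMul ν one) = if ν = 0 then 1 else 0 := fun ν => by
    rw [inner_char, ← hv ν]
    simp only [Complex.conj_ofReal]
  have hc0 : c ≠ 0 := by
    intro hc0
    -- As an element of L²(ρ), v is orthogonal to the positive characters, so ⟪v, h⟫ = ⟪v, 1⟫ = 1,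
    -- which excludes h = 0.
    have h1 := hproj hvc.toLp fun ν hν => by
      rw [hvchar, if_neg]
      rintro rfl
      simp at hν
    rw [inner_self_eq_zero.mp (hc.symm.trans hc0), inner_zero_right, ← charMul_zero one, hvchar,
      if_pos rfl] at h1
    exact zero_ne_one h1
  -- `|h|² = c v`
  have habs : ∀ᵐ z ∂ρ, conj (h z) * h z = c * v z := by
    have hI := integrable_conj_mul h h
    have hI' : Integrable (fun z => c * (v z : ℂ)) ρ := (hvc.integrable one_le_two).const_mul c
    have := ae_eq_zero_of_integral_character_mul (hI.sub hI') fun ν => by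
      simp only [Pi.sub_apply, mul_sub]
      rw [integral_sub (integrable_character_mul hI ν) (integrable_character_mul hI' ν),
        ← inner_charMul_right, hhh]
      simp only [mul_left_comm _ c]
      rw [integral_const_mul, hv]
      split_ifs <;> simp
    filter_upwards [this] with z hz
    exact sub_eq_zero.mp hz
  have hzero : ∀ᵐ z ∂ρ, h z = 0 ↔ v z = 0 := by
    filter_upwards [habs] with z hz
    constructor
    · intro h
      simpa [h, hc0] using hz.symm
    · intro h
      simpa [h] using hz
  -- the part of `φ` and of the constant `1` carried by `v ≠ 0`
  let N : Set Torus := {z | v z = 0}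
  have hN : MeasurableSet N := hvm (measurableSet_singleton 0)
  have hum : MemLp (Nᶜ.indicator fun _ => (1 : ℂ)) 2 ρ := hone.indicator hN.compl
  have hy1 : MemLp (fun z => conj (φ z)) 2 ρ := hφ.star
  have hy2 : MemLp (Nᶜ.indicator fun z => conj (φ z)) 2 ρ := hy1.indicator hN.compl
  let u : Lp ℂ 2 ρ := hum.toLp
  let y : Lp ℂ 2 ρ := hy1.toLp
  let y' : Lp ℂ 2 ρ := hy2.toLp
  have hu : u =ᵐ[ρ] Nᶜ.indicator fun _ => (1 : ℂ) := hum.coeFn_toLp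
  have hyf : y =ᵐ[ρ] fun z => conj (φ z) := hy1.coeFn_toLp
  have hyf' : y' =ᵐ[ρ] Nᶜ.indicator fun z => conj (φ z) := hy2.coeFn_toLp
  have hy : ∀ ν, 0 < logWeight ν → inner ℂ y (charMul ν one) = 0 := fun ν hν => by
    rw [inner_char, ← h0 ν hν]
    simp
  have hy'b : ∀ ν, inner ℂ y' (charMul ν h) = inner ℂ y (charMul ν h) := fun ν => by
    rw [inner_charMul_right, inner_charMul_right]
    refine integral_congr_ae ?_
    filter_upwards [hyf, hyf', hzero] with z h1 h2 h3
    rw [h1, h2]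
    by_cases hz : z ∈ N
    · rw [h3.mpr hz]; simp
    · rw [Set.indicator_of_mem (show z ∈ Nᶜ from hz)]
  have hub : ∀ ν, inner ℂ (charMul ν h) u = inner ℂ (charMul ν h) one := fun ν => by
    rw [inner_charMul_left, inner_charMul_left, inner_charMul_right, inner_charMul_right]
    refine integral_congr_ae ?_
    filter_upwards [hu, hone', hzero] with z h1 h2 h3
    rw [h1, h2]
    by_cases hz : z ∈ N
    · rw [h3.mpr hz]; simp
    · rw [Set.indicator_of_mem (show z ∈ Nᶜ from hz)]
  -- This a cancels the coefficient of `y'` along h; those along its strictly positive shifts vanish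
  -- already.
  obtain ⟨a, ha⟩ : ∃ a : ℂ, conj a * c = inner ℂ y one :=
    ⟨conj (inner ℂ y one / c), by rw [Complex.conj_conj, div_mul_cancel₀ _ hc0]⟩
  have hsplit : inner ℂ (y' - a • h) u = 0 := by
    refine inner_eq_zero_of_orthogonal_split (fun ν => charMul ν h) {ν | 0 ≤ logWeight ν}
      ?_ ?_ ?_ ?_
    · intro i hi j hj
      rw [hbb, if_neg]
      rintro rfl
      exact hj hi
    · intro ν hν
      rw [inner_sub_left, inner_smul_left, hy'b, hshift y hy ν hν, hhh]
      split_ifs with h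
      · rw [h, charMul_zero, ha, sub_self]
      · rw [hy ν (lt_of_le_of_ne hν fun h' => h
          (logWeight_injective (h'.symm.trans (map_zero _).symm))), mul_zero, sub_self]
    · intro ν hν
      rw [hub, inner_charMul_left, hh]
      rw [map_neg]
      exact neg_pos.mpr (not_le.mp hν)
    -- Completeness on {v ≠ 0}: orthogonality to all shifts of h forces conj x · h = 0 a.e., and h ≠
    -- 0 there.
    · intro x hx
      have hx0 := ae_eq_zero_of_integral_character_mul (integrable_conj_mul x h) fun ν => by
        rw [← inner_charMul_right, hx]
      rw [L2.inner_def]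
      refine integral_eq_zero_of_ae ?_
      filter_upwards [hx0, hzero, hu] with z h1 h2 h3
      rw [h3, RCLike.inner_apply]
      by_cases hz : z ∈ N
      · simp [Set.indicator_of_notMem (show z ∉ Nᶜ from not_not.mpr hz)]
      · have : h z ≠ 0 := fun h => hz (h2.mp h)
        have h1' : conj (x z) * h z = 0 := h1
        rw [(mul_eq_zero.mp h1').resolve_right this, mul_zero]
        rfl
  have hhu : inner ℂ h u = c := by
    have := hub 0
    rw [charMul_zero] at this
    rw [this, hc1]
  rw [inner_sub_left, inner_smul_left, hhu, ha, sub_eq_zero] at hsplit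
  have e1 : inner ℂ y' u = ∫ z in Nᶜ, φ z ∂ρ := by
    rw [L2.inner_def, ← integral_indicator hN.compl]
    refine integral_congr_ae ?_
    filter_upwards [hyf', hu] with z h1 h2
    rw [h1, h2, RCLike.inner_apply]
    by_cases hz : z ∈ Nᶜ <;> simp [hz]
  have e2 : inner ℂ y one = ∫ z, φ z ∂ρ := by
    rw [← charMul_zero one, inner_char]
    simp [character_zero]
  have e3 := integral_add_compl hN (hφ.integrable one_le_two)
  rw [e1, e2, ← e3] at hsplit
  exact right_eq_add.mp hsplit

/-! ### Complex measures with a density -/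

section Density

variable {X : Type*} [MeasurableSpace X]

lemma isFiniteMeasure_variation_withDensityᵥ {ρ : Measure X} {φ : X → ℂ} (hφ : Integrable φ ρ) :
    IsFiniteMeasure (ρ.withDensityᵥ φ).variation := by
  rw [Measure.variation_withDensityᵥ hφ]
  exact isFiniteMeasure_withDensity hφ.2.ne

/-- Integration of a bounded function against a complex measure with a density. -/
lemma vectorMeasure_integral_withDensityᵥ {ρ : Measure X} {φ : X → ℂ} (hφ : Integrable φ ρ)
    {f : X → ℂ} (hf : StronglyMeasurable f) {C : ℝ} (hC : ∀ x, ‖f x‖ ≤ C) :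
    ∫ᵛ x, f x ∂[ContinuousLinearMap.mul ℝ ℂ; ρ.withDensityᵥ φ] = ∫ x, f x * φ x ∂ρ := by
  have := isFiniteMeasure_variation_withDensityᵥ hφ
  rcases isEmpty_or_nonempty X with hX | ⟨⟨x₀⟩⟩
  · simp [VectorMeasure.integral_of_isEmpty, integral_of_isEmpty]
  have hC0 : 0 ≤ C := (norm_nonneg _).trans (hC x₀)
  have hsimple : ∀ g : SimpleFunc X ℂ,
      ∫ᵛ x, g x ∂[ContinuousLinearMap.mul ℝ ℂ; ρ.withDensityᵥ φ] = ∫ x, g x * φ x ∂ρ := by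
    have hint : ∀ g : SimpleFunc X ℂ, (ρ.withDensityᵥ φ).Integrable g := fun g =>
      SimpleFunc.integrable_of_isFiniteMeasure g
    have hint' : ∀ g : SimpleFunc X ℂ, Integrable (fun x => g x * φ x) ρ := fun g => by
      obtain ⟨C, hC⟩ := g.exists_forall_norm_le
      exact hφ.bdd_mul g.stronglyMeasurable.aestronglyMeasurable (Filter.Eventually.of_forall hC)
    intro g
    induction g using SimpleFunc.induction with
    | const c hs =>
      rename_i s
      have e1 : ⇑(SimpleFunc.piecewise s hs (SimpleFunc.const X c) (SimpleFunc.const X 0)) =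
          s.indicator fun _ => c := by
        ext x
        by_cases hx : x ∈ s <;> simp [hx]
      rw [e1, VectorMeasure.integral_indicator_const c hs, withDensityᵥ_apply hφ hs,
        ContinuousLinearMap.mul_apply', ← integral_const_mul, ← integral_indicator hs]
      refine integral_congr_ae (Filter.Eventually.of_forall fun x => ?_)
      by_cases hx : x ∈ s <;> simp [hx]
    | add hd hg₁ hg₂ =>
      rename_i g₁ g₂
      simp only [SimpleFunc.coe_add, Pi.add_apply, add_mul]
      rw [VectorMeasure.integral_fun_add (hint g₁) (hint g₂),
        integral_add (hint' g₁) (hint' g₂), hg₁, hg₂]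
  let F : ℕ → SimpleFunc X ℂ := hf.approxBounded C
  have hF : ∀ n x, ‖F n x‖ ≤ C := hf.norm_approxBounded_le hC0
  have hlim : ∀ x, Filter.Tendsto (fun n => F n x) Filter.atTop (nhds (f x)) := fun x =>
    hf.tendsto_approxBounded_of_norm_le (hC x)
  have h1 := VectorMeasure.tendsto_integral_of_dominated_convergence
    (μ := ρ.withDensityᵥ φ) (B := ContinuousLinearMap.mul ℝ ℂ) (fun _ => C)
    (fun n => (F n).stronglyMeasurable.aestronglyMeasurable) (integrable_const C)
    (fun n => Filter.Eventually.of_forall (hF n)) (Filter.Eventually.of_forall hlim)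
  have h2 := tendsto_integral_of_dominated_convergence (μ := ρ)
    (F := fun n x => F n x * φ x) (f := fun x => f x * φ x) (fun x => C * ‖φ x‖)
    (fun n => (F n).stronglyMeasurable.aestronglyMeasurable.mul hφ.1) (hφ.norm.const_mul C)
    (fun n => Filter.Eventually.of_forall fun x => by
      rw [norm_mul]; gcongr; exact hF n x)
    (Filter.Eventually.of_forall fun x => (hlim x).mul_const _)
  simp only [hsimple] at h1
  exact tendsto_nhds_unique h1 h2

/-- The Radon–Nikodym theorem for complex measures. -/
lemma complexMeasure_withDensityᵥ_rnDeriv_eq (μ : ComplexMeasure X) (ρ : Measure X) [SigmaFinite ρ]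
    (h : μ ≪ᵥ ρ.toENNRealVectorMeasure) : ρ.withDensityᵥ (μ.rnDeriv ρ) = μ := by
  obtain ⟨hre, him⟩ := (ComplexMeasure.absolutelyContinuous_ennreal_iff μ _).mp h
  have hint := ComplexMeasure.integrable_rnDeriv μ ρ
  ext s hs
  have h1 := DFunLike.congr_fun (SignedMeasure.withDensityᵥ_rnDeriv_eq _ ρ hre) s
  have h2 := DFunLike.congr_fun (SignedMeasure.withDensityᵥ_rnDeriv_eq _ ρ him) s
  rw [withDensityᵥ_apply (SignedMeasure.integrable_rnDeriv _ _) hs] at h1 h2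
  rw [withDensityᵥ_apply hint hs]
  apply Complex.ext
  · rw [← RCLike.re_eq_complex_re, ← integral_re hint.integrableOn]
    exact h1
  · rw [← RCLike.im_eq_complex_im, ← integral_im hint.integrableOn]
    exact h2

/-- Every complex measure has a bounded density with respect to some finite measure dominating a
given one. -/
lemma exists_bounded_density (μ : ComplexMeasure X) (m : Measure X) [IsFiniteMeasure m] :
    ∃ (ρ : Measure X) (φ : X → ℂ), IsFiniteMeasure ρ ∧ m ≤ ρ ∧ MemLp φ 2 ρ ∧
      μ = ρ.withDensityᵥ φ := by
  let ρ₀ : Measure X := (ComplexMeasure.re μ).totalVariation +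
    (ComplexMeasure.im μ).totalVariation + m
  have hac : μ ≪ᵥ ρ₀.toENNRealVectorMeasure := by
    rw [ComplexMeasure.absolutelyContinuous_ennreal_iff,
      SignedMeasure.absolutelyContinuous_ennreal_iff,
      SignedMeasure.absolutelyContinuous_ennreal_iff,
      VectorMeasure.ennrealToMeasure_toENNRealVectorMeasure]
    constructor
    · exact Measure.absolutelyContinuous_of_le
        ((Measure.le_add_right le_rfl).trans (Measure.le_add_right le_rfl))
    · exact Measure.absolutelyContinuous_of_le
        ((Measure.le_add_left le_rfl).trans (Measure.le_add_right le_rfl))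
  have hμ := complexMeasure_withDensityᵥ_rnDeriv_eq μ ρ₀ hac
  have hint := ComplexMeasure.integrable_rnDeriv μ ρ₀
  set ψ := hint.1.mk _
  have hψ : μ.rnDeriv ρ₀ =ᵐ[ρ₀] ψ := hint.1.ae_eq_mk
  have hψm : StronglyMeasurable ψ := hint.1.stronglyMeasurable_mk
  have hψi : Integrable ψ ρ₀ := hint.congr hψ
  -- Weighting by 1 + |ψ| bounds the new density by 1, keeps the measure finite because ψ is
  -- integrable, and keeps it above m.
  let w : X → NNReal := fun x => 1 + ‖ψ x‖₊
  have hwm : Measurable w := measurable_const.add hψm.nnnorm.measurable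
  let φ : X → ℂ := fun x => (w x)⁻¹ • ψ x
  have hwφ : ∀ x, w x • φ x = ψ x := fun x => by
    simp only [φ]
    rw [smul_smul, mul_inv_cancel₀ (by positivity), one_smul]
  have hφb : ∀ x, ‖φ x‖ ≤ 1 := fun x => by
    simp only [φ, w, NNReal.smul_def, norm_smul, Real.norm_eq_abs, NNReal.coe_inv, NNReal.coe_add,
      NNReal.coe_one, coe_nnnorm]
    rw [abs_of_nonneg (by positivity), inv_mul_le_iff₀ (by positivity)]
    linarith
  have hwfin : IsFiniteMeasure (ρ₀.withDensity fun x => (w x : ℝ≥0∞)) := by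
    refine isFiniteMeasure_withDensity ?_
    simp only [w, ENNReal.coe_add, ENNReal.coe_one]
    rw [lintegral_add_left measurable_const]
    exact ENNReal.add_ne_top.mpr ⟨by simp, hψi.2.ne⟩
  refine ⟨ρ₀.withDensity fun x => (w x : ℝ≥0∞), φ, hwfin, ?_, ?_, ?_⟩
  · calc m ≤ ρ₀ := Measure.le_add_left le_rfl
      _ = ρ₀.withDensity 1 := withDensity_one.symm
      _ ≤ _ := withDensity_mono (Filter.Eventually.of_forall fun x => by simp [w])
  · exact MemLp.of_bound (hwm.inv.stronglyMeasurable.smul hψm).aestronglyMeasurable 1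
      (Filter.Eventually.of_forall hφb)
  · have hfun : w • φ = ψ := funext hwφ
    rw [← withDensityᵥ_smul_eq_withDensityᵥ_withDensity hwm.aemeasurable (by rwa [hfun]), hfun,
      ← WithDensityᵥEq.congr_ae hψ, hμ]

end Density

/-! ### Analytic measures -/

lemma measureFourierCoeff_withDensityᵥ {ρ : Measure Torus} {φ : Torus → ℂ} (hφ : Integrable φ ρ)
    (ν : ℕ →₀ ℤ) :
    measureFourierCoeff (ρ.withDensityᵥ φ) ν = ∫ z, conj (character ν z) * φ z ∂ρ :=
  vectorMeasure_integral_withDensityᵥ hφ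
    (Complex.continuous_conj.comp (continuous_character ν)).stronglyMeasurable (C := 1)
    fun z => by rw [RCLike.norm_conj, norm_character]

/-- The density of an analytic measure vanishes on the part that is singular to the Haar
measure. -/
lemma density_ae_eq_zero_of_analytic {ρ : Measure Torus} [IsFiniteMeasure ρ] {v : Torus → ℝ}
    (hvm : Measurable v) (hvb : ∀ᵐ z ∂ρ, ‖v z‖ ≤ 1)
    (hv : ∀ ν, ∫ z, character ν z * v z ∂ρ = if ν = 0 then 1 else 0)
    {φ : Torus → ℂ} (hφ : MemLp φ 2 ρ)
    (han : ∀ ν, ¬ IsNonneg ν → ∫ z, character (-ν) z * φ z ∂ρ = 0) :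
    ∀ᵐ z ∂ρ, v z = 0 → φ z = 0 := by
  classical
  let N : Set Torus := {z | v z = 0}
  have hN : MeasurableSet N := hvm (measurableSet_singleton 0)
  have hφi : Integrable φ ρ := hφ.integrable one_le_two
  have hvc : MemLp (fun z => (v z : ℂ)) 2 ρ :=
    MemLp.of_bound (Complex.measurable_ofReal.comp hvm).aestronglyMeasurable 1
      (hvb.mono fun z hz => by rwa [Complex.norm_real])
  have hvi : Integrable (fun z => (v z : ℂ)) ρ := hvc.integrable one_le_two
  have key : ∀ κ, ∫ z, character κ z * N.indicator φ z ∂ρ = 0 := by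
    intro κ
    let S : Finset (ℕ →₀ ℤ) := (finite_isNonneg_logWeight_lt (logWeight (-κ))).toFinset
    let a : (ℕ →₀ ℤ) → ℂ := fun ν => ∫ z, character (-ν) z * φ z ∂ρ
    -- The sum removes exactly the coefficients of μ that multiplication by the character κ moves to
    -- negative indices. It carries the factor v, so ψ agrees with that character times φ on N.
    let ψ : Torus → ℂ := fun z =>
      character κ z * φ z - ∑ ν ∈ S, a ν * (character (ν + κ) z * v z)
    have hψ : MemLp ψ 2 ρ := (memLp_character_mul κ hφ).sub
      (memLp_finsetSum S fun ν _ => (memLp_character_mul (ν + κ) hvc).const_mul (a ν))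
    have h0 : ∀ l, 0 < logWeight l → ∫ z, character l z * ψ z ∂ρ = 0 := by
      intro l hl
      have e : ∀ z, character l z * ψ z = character (l + κ) z * φ z -
          ∑ ν ∈ S, a ν * (character (ν + (l + κ)) z * v z) := fun z => by
        simp only [ψ, mul_sub, Finset.mul_sum, character_add]
        congr 1
        · ring
        · exact Finset.sum_congr rfl fun ν _ => by ring
      simp only [e]
      rw [integral_sub (integrable_character_mul hφi _) (integrable_finsetSum _ fun ν _ =>
        (integrable_character_mul hvi _).const_mul _), integral_finsetSum _ fun ν _ =>
        (integrable_character_mul hvi _).const_mul _]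
      simp only [integral_const_mul, hv, mul_ite, mul_one, mul_zero, add_eq_zero_iff_eq_neg]
      rw [Finset.sum_ite_eq']
      have ha : a (-(l + κ)) = ∫ z, character (l + κ) z * φ z ∂ρ := by simp only [a, neg_neg]
      split_ifs with hmem
      · rw [ha, sub_self]
      · rw [sub_zero, ← ha]
        refine han _ fun hnn => hmem ?_
        simp only [S, Set.Finite.mem_toFinset, Set.mem_ofPred_eq]
        refine ⟨hnn, ?_⟩
        simp only [map_neg, map_add]
        linarith
    have hs := integral_singular_eq_zero hvm hvb hv hψ h0
    rw [← integral_indicator hN] at hs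
    rw [← hs]
    refine integral_congr_ae (Filter.Eventually.of_forall fun z => ?_)
    by_cases hz : z ∈ N
    · have hz' : v z = 0 := hz
      simp [hz, ψ, hz']
    · simp [hz]
  have := ae_eq_zero_of_integral_character_mul (hφi.indicator hN) key
  filter_upwards [this] with z hz hvz
  rwa [Set.indicator_of_mem (show z ∈ N from hvz)] at hz

/-- An analytic measure has an integrable density with respect to the Haar measure. -/
lemma exists_density_of_analytic (μ : ComplexMeasure Torus) (hμ : IsAnalyticMeasure μ) :
    ∃ g : Torus → ℂ, Integrable g haar ∧ μ = haar.withDensityᵥ g := by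
  obtain ⟨ρ, φ, hρ, hle, hφ, rfl⟩ := exists_bounded_density μ haar
  have hac : haar ≪ ρ := Measure.absolutelyContinuous_of_le hle
  have hφi : Integrable φ ρ := hφ.integrable one_le_two
  have : haar.HaveLebesgueDecomposition ρ := Measure.haveLebesgueDecomposition_of_sigmaFinite _ _
  let v : Torus → ℝ := fun z => (haar.rnDeriv ρ z).toReal
  have hvm : Measurable v := (Measure.measurable_rnDeriv _ _).ennreal_toReal
  have hvb : ∀ᵐ z ∂ρ, ‖v z‖ ≤ 1 := by
    filter_upwards [Measure.rnDeriv_le_one_of_le hle] with z hz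
    rw [Real.norm_of_nonneg ENNReal.toReal_nonneg]
    exact ENNReal.toReal_le_of_le_ofReal zero_le_one (by simpa using hz)
  have hv : ∀ ν, ∫ z, character ν z * v z ∂ρ = if ν = 0 then 1 else 0 := fun ν => by
    rw [← integral_character_haar, ← integral_rnDeriv_smul hac]
    refine integral_congr_ae (Filter.Eventually.of_forall fun z => ?_)
    simp only [Complex.real_smul, v]
    ring
  have hzero := density_ae_eq_zero_of_analytic hvm hvb hv hφ fun ν hν => by
    have := hμ ν hν
    rw [measureFourierCoeff_withDensityᵥ hφi] at this
    simpa only [conj_character] using this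
  -- The candidate density is φ/v; the convention 0⁻¹ = 0 is harmless because φ vanishes where v
  -- does.
  have hsmul : (fun z => (haar.rnDeriv ρ z).toReal • ((v z)⁻¹ • φ z)) =ᵐ[ρ] φ := by
    filter_upwards [hzero] with z hz
    change v z • ((v z)⁻¹ • φ z) = φ z
    by_cases hvz : v z = 0
    · rw [hvz, hz hvz]; simp
    · rw [smul_smul, mul_inv_cancel₀ hvz, one_smul]
  have hg : Integrable (fun z => (v z)⁻¹ • φ z) haar :=
    (integrable_rnDeriv_smul_iff hac).mp (hφi.congr hsmul.symm)
  refine ⟨_, hg, ?_⟩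
  rw [← withDensityᵥ_rnDeriv_smul hac hg]
  exact (WithDensityᵥEq.congr_ae hsmul).symm

end InfiniteTorus

/-- The F. and M. Riesz theorem on the infinite-dimensional torus. -/
theorem mainTheorem2 (μ : ComplexMeasure InfiniteTorus.Torus)
    (hμ : InfiniteTorus.IsAnalyticMeasure μ) :
    μ ≪ᵥ InfiniteTorus.haar.toENNRealVectorMeasure ∧
      ∃ g ∈ InfiniteTorus.hardySpace 1, μ = InfiniteTorus.haar.withDensityᵥ g := by
  obtain ⟨g, hg, hμg⟩ := InfiniteTorus.exists_density_of_analytic μ hμ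
  have hμg' : μ = InfiniteTorus.haar.withDensityᵥ ((memLp_one_iff_integrable.mpr hg).toLp g) := by
    rw [hμg]
    exact WithDensityᵥEq.congr_ae (MemLp.coeFn_toLp _).symm
  refine ⟨?_, _, fun ν hν => ?_, hμg'⟩
  · refine VectorMeasure.AbsolutelyContinuous.mk fun s hs h0 => ?_
    rw [Measure.toENNRealVectorMeasure_apply_measurable hs] at h0
    rw [hμg, withDensityᵥ_apply hg hs, Measure.restrict_zero_set h0, integral_zero_measure]
  · rw [← hμ ν hν]
    conv_rhs => rw [hμg']
    rw [InfiniteTorus.measureFourierCoeff_withDensityᵥ (L1.integrable_coeFn _)]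
    rfl
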